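/- **Set terms and data formulae.** Set variables range over finite subsets of $\mathbb Z$, integer variables over $\mathbb Z$. Set terms and integer terms are $T_s::=\emptyset\mid S\mid\{T_i\}\mid T_s\cup T_s\mid T_s\cap T_s\mid T_s\setminus T_s$ and $T_i::=c\mid x\mid\min(T_s)\mid\max(T_s)$; $\min\emptyset$ and $\max\emptyset$ are undefined, and an atomic formula (points-to atoms included) that contains an undefined term is false. A data formula $\Delta$ is a Boolean combination of atoms $T_s\asymp T_s$ ($\asymp\,\in\{=,\subseteq,\supseteq,\subset,\supset\}$), $T_i\bowtie T_i+c$ and $T_m\bowtie 0$ ($\bowtie\,\in\{=,\le,\ge\}$, $T_m$ built by $+,-$ from constants, integer variables, minima and maxima of set terms). A difference-bound set formula is a conjunction of atoms $S=S'\cup T$ and $t\bowtie t'+c$, where $t,t'$ have the form $\min(S)$ or $\max(S)$ and $T$ is a union of sets $\emptyset$, $\{\min (S)\}$, $\{\max (S)\}$. **Linearly compositional predicates.** $P$ is given by the rules $$P(E,\vec\alpha;F,\vec\beta;\vec\xi)::=E=F\wedge\vec\alpha=\vec\beta\wedge\mathtt{emp},\qquad P(E,\vec\alpha;F,\vec\beta;\vec\xi)::=\exists\vec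 X\,\exists\vec S.\ \varphi\wedge E\mapsto(\rho)*P(Y,\vec\gamma;F,\vec\beta;\vec\xi),$$ where $E,F$ and $\vec X$ are location variables, $\vec S$ are set variables, $\vec\alpha,\vec\beta$ are matching tuples of location and set variables, and $\rho$ is a list of entries $(f,X)$ (location field, location variable) and $(d,T_i)$ (data field, integer term) with pairwise distinct fields, such that: (C1) $F,\vec\beta$ do not occur in $\varphi$ or $E\mapsto(\rho)$; (C2) $\varphi$ is a difference-bound set formula; (C3) the variables of each atom of $\varphi$ are among $\{\alpha_i,\gamma_i\}$ for some $i$; (C4) every variable occurs at most once in $P(Y,\vec\gamma;F,\vec\beta;\vec\xi)$ and at most once in $\rho$; (C5) $\vec\xi$ consists of location variables, and all location variables of $\vec\alpha,\vec\xi,\vec X$ occur in $\rho$; (C6) $Y\in\vec X$ and $\vec\gamma\subseteq\{E\}\cup\vec X\cup\vec S$. **Formulae.** An $\mathsf{SLID}^S_{LC}[P]$ formula is $\phi=\Pi\wedge\Delta\wedge\Sigma$, where $\Pi$ is a conjunction of atoms $E=F$, $E\ne F$, $\Delta$ is a data formula, and $\Sigma$ is a separating conjunction of $\mathtt{emp}$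 and of atoms $a_1,\dots,a_n$, each a points-to atom $E\mapsto(\rho)$ whose fields are pairwise distinct and are exactly those in the rule of $P$, or a predicate atom $P(Z_1,\vec\mu;Z_2,\vec\nu;\vec\chi)$. Formulae are interpreted in states $(s,h)$ over an infinite set $\mathbb L$ of locations, with the precise semantics. Here $h$ is a partial function from pairs (location, field) to values in which all allocated locations have the same fields; $*$ splits $h$ into two parts with disjoint sets of allocated locations; $\mathtt{emp}$ holds in the empty heap; $E\mapsto(\rho)$ holds if $s(E)$ is the only allocated location and its fields store the values given by $\rho$; $P$ is the least fixed point of its rules. **Abstraction.** Let $\mathsf{dt}$ be the projection of a tuple to its set variables, $\varphi_P(\mathsf{dt}(\vec\alpha),\mathsf{dt}(\vec\beta)):=\varphi[\mathsf{dt}(\vec\beta)/\mathsf{dt}(\vec\gamma)]$, and let $\mathsf{TC}[\varphi_P]$ be the reflexive transitive closure of the relation between tuples of finite sets that $\varphi_P$ defines. If $E$ occurs in $\vec\gamma$, let $j_0$ be the index with $\gamma_{j_0}=E$. For each atom $a_i$ with root $Z$ (that is, $E$ or $Z_1$) introduce a Boolean variable $[Z,i]$, and for each predicate atom $a_i$ also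 $[\nu_{j_0},i]$ if $E$ occurs in $\vec\gamma$. For a predicate atom $a_i$ let $\vec\gamma_1,\vec\gamma_2$ be fresh and $$\mathsf{Ufld}_1(a_i)=(Z_1=\nu_{j_0})\wedge\varphi_P(\mathsf{dt}(\vec\mu),\mathsf{dt}(\vec\nu)),$$ $$\mathsf{Ufld}_{\ge2}(a_i)=(Z_1\ne\nu_{j_0})\wedge(Z_1\neq\gamma_{2,j_0})\wedge\varphi_P(\mathsf{dt}(\vec\mu),\mathsf{dt}(\vec\gamma_1))\wedge\varphi_P(\mathsf{dt}(\vec\gamma_1),\mathsf{dt}(\vec\gamma_2))\wedge\mathsf{TC}[\varphi_P](\mathsf{dt}(\vec\gamma_2),\mathsf{dt}(\vec\nu)),$$ where the (in)equalities with index $j_0$ are dropped if $E$ does not occur in $\vec\gamma$. Let $\mathsf{Abs}(a_i)=[E,i]$ for a points-to atom and $$\mathsf{Abs}(a_i)=(Z_1=Z_2\wedge\vec\mu=\vec\nu)\vee(B_i\wedge\mathsf{Ufld}_1(a_i))\vee(B_i\wedge\mathsf{Ufld}_{\ge2}(a_i))$$ for a predicate atom, where $B_i$ is $[Z_1,i]\wedge[\nu_{j_0},i]$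 if $E$ occurs in $\vec\gamma$, and $[Z_1,i]$ otherwise. Finally $$\mathsf{Abs}(\phi)=\Pi\wedge\Delta\wedge\bigwedge_{i}\mathsf{Abs}(a_i)\wedge\bigwedge_{[Z,i],[Z',j],\,i\ne j}\bigl((Z=Z'\wedge[Z,i])\to\neg[Z',j]\bigr).$$ **Guards.** The predicate $P$ is *guarded* if, for all values of $\vec\alpha,\vec\gamma$ satisfying $\varphi$, the set variables in $\vec S$ outside $\vec\gamma$ have values for which all data terms of $\rho$ are defined. The formula $\phi$ is *guarded* if every assignment satisfying $\Delta$ makes all data terms in the points-to atoms of $\phi$ defined. **Proposition.** Let $P$ be linearly compositional and $\phi$ an $\mathsf{SLID}^S_{LC}[P]$ formula. 1. If $P$ and $\phi$ are guarded, then $\phi$ is satisfiable iff $\mathsf{Abs}(\phi)$ is satisfiable. 2. If $P$ is guarded, then $\phi$ is satisfiable iff $\mathsf{Abs}(\phi)$ is satisfied by some assignment for which all data terms in the points-to atoms of $\phi$ are defined. 3. In every case, if $\phi$ is satisfiable then $\mathsf{Abs}(\phi)$ is satisfiable. -/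

import Mathlib

namespace SLID

/-! ### Terms and quantifier-free set constraints with Presburger arithmetic -/

/-- Comparisons `=`, `≤`, `≥` between integers. -/
inductive Cmp
  | eq | le | ge

def Cmp.Holds : Cmp → ℤ → ℤ → Prop
  | .eq, a, b => a = b
  | .le, a, b => a ≤ b
  | .ge, a, b => a ≥ b

/-- Comparisons `=`, `⊆`, `⊇`, `⊂`, `⊃` between finite sets. -/
inductive SetCmp
  | eq | sub | sup | ssub | ssup

def SetCmp.Holds : SetCmp → Finset ℤ → Finset ℤ → Prop
  | .eq, A, B => A = B
  | .sub, A, B => A ⊆ B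
  | .sup, A, B => B ⊆ A
  | .ssub, A, B => A ⊂ B
  | .ssup, A, B => B ⊂ A

/-- The minimum of a finite set of integers, undefined on `∅`. -/
def smin (A : Finset ℤ) : Option ℤ := if h : A.Nonempty then some (A.min' h) else none

/-- The maximum of a finite set of integers, undefined on `∅`. -/
def smax (A : Finset ℤ) : Option ℤ := if h : A.Nonempty then some (A.max' h) else none

section
universe u v

mutual
/-- Set terms over set variables `SV` and integer variables `IV`. -/
inductive STerm (IV : Type u) (SV : Type v)
  | empty : STerm IV SV
  | var : SV → STerm IV SV
  | single : ITerm IV SV → STerm IV SV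
  | union : STerm IV SV → STerm IV SV → STerm IV SV
  | inter : STerm IV SV → STerm IV SV → STerm IV SV
  | sdiff : STerm IV SV → STerm IV SV → STerm IV SV
/-- Integer terms `c`, `x`, `min(T)`, `max(T)`. -/
inductive ITerm (IV : Type u) (SV : Type v)
  | const : ℤ → ITerm IV SV
  | var : IV → ITerm IV SV
  | min : STerm IV SV → ITerm IV SV
  | max : STerm IV SV → ITerm IV SV
end

end

section
variable {IV SV : Type*}

mutual
/-- Value of a set term; `none` means undefined. -/
def STerm.eval (si : IV → ℤ) (ss : SV → Finset ℤ) : STerm IV SV → Option (Finset ℤ)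
  | .empty => some ∅
  | .var S => some (ss S)
  | .single t => (ITerm.eval si ss t).map (fun n => {n})
  | .union t u => (STerm.eval si ss t).bind fun A => (STerm.eval si ss u).map fun B => A ∪ B
  | .inter t u => (STerm.eval si ss t).bind fun A => (STerm.eval si ss u).map fun B => A ∩ B
  | .sdiff t u => (STerm.eval si ss t).bind fun A => (STerm.eval si ss u).map fun B => A \ B
/-- Value of an integer term; `none` means undefined. -/
def ITerm.eval (si : IV → ℤ) (ss : SV → Finset ℤ) : ITerm IV SV → Option ℤ
  | .const c => some c
  | .var x => some (si x)
  | .min t => (STerm.eval si ss t).bind smin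
  | .max t => (STerm.eval si ss t).bind smax
end

mutual
/-- The occurrences of set variables in a set term, with multiplicity. -/
def STerm.svars : STerm IV SV → List SV
  | .empty => []
  | .var S => [S]
  | .single t => ITerm.svars t
  | .union t u => STerm.svars t ++ STerm.svars u
  | .inter t u => STerm.svars t ++ STerm.svars u
  | .sdiff t u => STerm.svars t ++ STerm.svars u
/-- The occurrences of set variables in an integer term, with multiplicity. -/
def ITerm.svars : ITerm IV SV → List SV
  | .const _ => []
  | .var _ => []
  | .min t => STerm.svars t
  | .max t => STerm.svars t
end

end

/-- Presburger terms. -/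
inductive MTerm (IV SV : Type*)
  | const : ℤ → MTerm IV SV
  | var : IV → MTerm IV SV
  | min : STerm IV SV → MTerm IV SV
  | max : STerm IV SV → MTerm IV SV
  | add : MTerm IV SV → MTerm IV SV → MTerm IV SV
  | sub : MTerm IV SV → MTerm IV SV → MTerm IV SV

def MTerm.eval {IV SV : Type*} (si : IV → ℤ) (ss : SV → Finset ℤ) : MTerm IV SV → Option ℤ
  | .const c => some c
  | .var x => some (si x)
  | .min t => (t.eval si ss).bind smin
  | .max t => (t.eval si ss).bind smax
  | .add t u => (t.eval si ss).bind fun a => (u.eval si ss).map fun b => a + b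
  | .sub t u => (t.eval si ss).bind fun a => (u.eval si ss).map fun b => a - b

/-- Data formulae: quantifier-free set constraints with Presburger arithmetic. -/
inductive PS (IV SV : Type*)
  | setCmp : STerm IV SV → SetCmp → STerm IV SV → PS IV SV
  | diff : ITerm IV SV → Cmp → ITerm IV SV → ℤ → PS IV SV
  | lin : MTerm IV SV → Cmp → PS IV SV
  | and : PS IV SV → PS IV SV → PS IV SV
  | not : PS IV SV → PS IV SV

/-- Satisfaction of data formulae; an atomic formula with an undefined term is false. -/
def PS.Sat {IV SV : Type*} (si : IV → ℤ) (ss : SV → Finset ℤ) : PS IV SV → Prop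
  | .setCmp t r u => ∃ A B, t.eval si ss = some A ∧ u.eval si ss = some B ∧ r.Holds A B
  | .diff t r u c => ∃ a b, t.eval si ss = some a ∧ u.eval si ss = some b ∧ r.Holds a (b + c)
  | .lin t r => ∃ a, t.eval si ss = some a ∧ r.Holds a 0
  | .and Δ Δ' => Δ.Sat si ss ∧ Δ'.Sat si ss
  | .not Δ => ¬ Δ.Sat si ss

/-! ### Difference-bound set constraints -/

/-- `min(S)` and `max(S)` for a set variable `S`. -/
inductive DTerm (SV : Type*)
  | min : SV → DTerm SV
  | max : SV → DTerm SV

/-- `∅`, `{min(S)}`, `{max(S)}` and unions of these. -/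
inductive DSTerm (SV : Type*)
  | empty : DSTerm SV
  | single : DTerm SV → DSTerm SV
  | union : DSTerm SV → DSTerm SV → DSTerm SV

/-- `S = S' ∪ T` and `T₁ ⋈ T₂ + c`. -/
inductive DAtom (SV : Type*)
  | set : SV → SV → DSTerm SV → DAtom SV
  | diff : DTerm SV → Cmp → DTerm SV → ℤ → DAtom SV

/-- A difference-bound set formula: the conjunction of a list of atoms. -/
abbrev DBS (SV : Type*) := List (DAtom SV)

section
variable {SV SV' : Type*}

def DTerm.eval (ss : SV → Finset ℤ) : DTerm SV → Option ℤ
  | .min S => smin (ss S)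
  | .max S => smax (ss S)

def DSTerm.eval (ss : SV → Finset ℤ) : DSTerm SV → Option (Finset ℤ)
  | .empty => some ∅
  | .single t => (t.eval ss).map fun n => {n}
  | .union t u => (t.eval ss).bind fun A => (u.eval ss).map fun B => A ∪ B

def DAtom.Sat (ss : SV → Finset ℤ) : DAtom SV → Prop
  | .set S S' t => ∃ A, t.eval ss = some A ∧ ss S = ss S' ∪ A
  | .diff t r u c => ∃ a b, t.eval ss = some a ∧ u.eval ss = some b ∧ r.Holds a (b + c)

def DBS.Sat (ss : SV → Finset ℤ) (φ : DBS SV) : Prop := ∀ a ∈ φ, a.Sat ss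

def DTerm.vars : DTerm SV → List SV
  | .min S => [S]
  | .max S => [S]

def DSTerm.vars : DSTerm SV → List SV
  | .empty => []
  | .single t => t.vars
  | .union t u => t.vars ++ u.vars

def DAtom.vars : DAtom SV → List SV
  | .set S S' t => S :: S' :: t.vars
  | .diff t _ u _ => t.vars ++ u.vars

def DTerm.subst (f : SV → SV') : DTerm SV → DTerm SV'
  | .min S => .min (f S)
  | .max S => .max (f S)

def DSTerm.subst (f : SV → SV') : DSTerm SV → DSTerm SV'
  | .empty => .empty
  | .single t => .single (t.subst f)
  | .union t u => .union (t.subst f) (u.subst f)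

def DAtom.subst (f : SV → SV') : DAtom SV → DAtom SV'
  | .set S S' t => .set (f S) (f S') (t.subst f)
  | .diff t r u c => .diff (t.subst f) r (u.subst f) c

/-- Replacement of variables in a formula. -/
def DBS.subst (f : SV → SV') (φ : DBS SV) : DBS SV' := List.map (DAtom.subst f) φ

end

/-! ### Heaps -/

/-- A heap over locations `L`, location fields `𝔽` and data fields `𝔻`: a partial function from
`L × (𝔽 ∪ 𝔻)` to `L ∪ ℤ` that respects types and is field-consistent. -/
structure Heap (L 𝔽 𝔻 : Type*) where
  loc : L → 𝔽 → Option L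
  dat : L → 𝔻 → Option ℤ
  consistent : ∀ l l' : L,
    ((∃ f, (loc l f).isSome) ∨ ∃ d, (dat l d).isSome) →
    ((∃ f, (loc l' f).isSome) ∨ ∃ d, (dat l' d).isSome) →
    (∀ f, (loc l f).isSome ↔ (loc l' f).isSome) ∧ ∀ d, (dat l d).isSome ↔ (dat l' d).isSome

section
variable {L 𝔽 𝔻 : Type*}

/-- The allocated locations. -/
def Heap.ldom (h : Heap L 𝔽 𝔻) : Set L :=
  {l | (∃ f, (h.loc l f).isSome) ∨ ∃ d, (h.dat l d).isSome}

/-- The fields used in the heap. -/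
def Heap.flds (h : Heap L 𝔽 𝔻) : Set (𝔽 ⊕ 𝔻) :=
  {x | ∃ l, match x with
    | .inl f => (h.loc l f).isSome
    | .inr d => (h.dat l d).isSome}

/-- `h = h₁ ⊎ h₂` for two heaps with disjoint sets of allocated locations that are
field-compatible (the empty heap being compatible with every heap). -/
def Heap.IsUnion (h h₁ h₂ : Heap L 𝔽 𝔻) : Prop :=
  Disjoint h₁.ldom h₂.ldom ∧
  (h₁.ldom = ∅ ∨ h₂.ldom = ∅ ∨ h₁.flds = h₂.flds) ∧
  (∀ l f, h.loc l f = (h₁.loc l f).or (h₂.loc l f)) ∧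
  ∀ l d, h.dat l d = (h₁.dat l d).or (h₂.dat l d)

end

/-- A field entry `(f, X)` or `(d, T)` of a points-to atom. -/
inductive Entry (𝔽 𝔻 LV IV SV : Type*)
  | loc : 𝔽 → LV → Entry 𝔽 𝔻 LV IV SV
  | dat : 𝔻 → ITerm IV SV → Entry 𝔽 𝔻 LV IV SV

section
variable {L 𝔽 𝔻 LV IV SV : Type*}

def Entry.field : Entry 𝔽 𝔻 LV IV SV → 𝔽 ⊕ 𝔻
  | .loc f _ => .inl f
  | .dat d _ => .inr d

/-- Occurrences of location variables. -/
def Entry.lvars : Entry 𝔽 𝔻 LV IV SV → List LV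
  | .loc _ X => [X]
  | .dat _ _ => []

/-- Occurrences of set variables. -/
def Entry.svars : Entry 𝔽 𝔻 LV IV SV → List SV
  | .loc _ _ => []
  | .dat _ t => t.svars

/-- The set of fields of `ρ`. -/
def fieldSet (ρ : List (Entry 𝔽 𝔻 LV IV SV)) : Set (𝔽 ⊕ 𝔻) := {x | ∃ e ∈ ρ, e.field = x}

/-- All data terms stored by `ρ` are defined. -/
def RhoDefined (ρ : List (Entry 𝔽 𝔻 LV IV SV)) (si : IV → ℤ) (ss : SV → Finset ℤ) : Prop :=
  ∀ d t, Entry.dat d t ∈ ρ → (t.eval si ss).isSome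

/-- The heap satisfies `E ↦ (ρ)`, where `l` is the value of `E`; an atom with an undefined term
is false. -/
def Heap.PointsTo (h : Heap L 𝔽 𝔻) (l : L) (ρ : List (Entry 𝔽 𝔻 LV IV SV))
    (sl : LV → L) (si : IV → ℤ) (ss : SV → Finset ℤ) : Prop :=
  h.ldom = {l} ∧
  (∀ f X, Entry.loc f X ∈ ρ → h.loc l f = some (sl X)) ∧
  ∀ d t, Entry.dat d t ∈ ρ → ∃ n, t.eval si ss = some n ∧ h.dat l d = some n

end

/-! ### Inductive predicates -/

/-- Location variables of the inductive rule: `E`, `F`, the location variables of `α`, `β`, the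
static parameters `ξ`, and the existentially quantified `X`. -/
inductive RLVar (nl nst nX : ℕ)
  | root : RLVar nl nst nX
  | last : RLVar nl nst nX
  | src : Fin nl → RLVar nl nst nX
  | dst : Fin nl → RLVar nl nst nX
  | stat : Fin nst → RLVar nl nst nX
  | ex : Fin nX → RLVar nl nst nX

/-- Set variables of the inductive rule: those of `α`, `β`, and the existentially quantified
`S`. -/
inductive RSVar (ns nS : ℕ)
  | src : Fin ns → RSVar ns nS
  | dst : Fin ns → RSVar ns nS
  | ex : Fin nS → RSVar ns nS

/-- The inductive rule
`P(E, α; F, β; ξ) ::= ∃ X ∃ S. φ ∧ E ↦ (ρ) * P(Y, γ; F, β; ξ)` of a predicate `P` (the base rule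
`E = F ∧ α = β ∧ emp` is the same for all predicates).
Besides `E`, the source parameters are `nl` locations and `ns` sets; `γL` and `γS` are
the location and the set components of `γ`. -/
structure IndPred (𝔽 𝔻 : Type*) where
  nl : ℕ
  ns : ℕ
  nst : ℕ
  nX : ℕ
  nS : ℕ
  φ : DBS (RSVar ns nS)
  ρ : List (Entry 𝔽 𝔻 (RLVar nl nst nX) Empty (RSVar ns nS))
  Y : RLVar nl nst nX
  γL : Fin nl → RLVar nl nst nX
  γS : Fin ns → RSVar ns nS

namespace IndPred
variable {𝔽 𝔻 : Type*} (P : IndPred 𝔽 𝔻)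

/-- The syntactic conditions on the inductive rule; `c2` (the data constraint is a difference-bound
set formula) is part of the type of `IndPred`. `fields` says that `ρ` gives every field at most one
value. -/
structure LinearlyCompositional : Prop where
  fields : (P.ρ.map Entry.field).Nodup
  c1_φ : ∀ a ∈ P.φ, ∀ j, RSVar.dst j ∉ a.vars
  c1_last : RLVar.last ∉ P.ρ.flatMap Entry.lvars
  c1_dst : ∀ j, RLVar.dst j ∉ P.ρ.flatMap Entry.lvars
  c1_dst_set : ∀ j, RSVar.dst j ∉ P.ρ.flatMap Entry.svars
  c3 : ∀ a ∈ P.φ, ∃ i, ∀ v ∈ a.vars, v = RSVar.src i ∨ v = P.γS i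
  c4_loc : (P.Y :: (List.ofFn P.γL ++ (RLVar.last :: (List.ofFn RLVar.dst ++
    List.ofFn RLVar.stat)))).Nodup
  c4_set : (List.ofFn P.γS ++ List.ofFn RSVar.dst).Nodup
  c4_ρ_loc : (P.ρ.flatMap Entry.lvars).Nodup
  c4_ρ_set : (P.ρ.flatMap Entry.svars).Nodup
  c5_src : ∀ j, RLVar.src j ∈ P.ρ.flatMap Entry.lvars
  c5_stat : ∀ j, RLVar.stat j ∈ P.ρ.flatMap Entry.lvars
  c5_ex : ∀ j, RLVar.ex j ∈ P.ρ.flatMap Entry.lvars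
  c6_Y : ∃ j, P.Y = RLVar.ex j
  c6_loc : ∀ i, P.γL i = RLVar.root ∨ ∃ j, P.γL i = RLVar.ex j
  c6_set : ∀ i, ∃ j, P.γS i = RSVar.ex j

/-- Values of the location variables of the rule. -/
def lval {L : Type*} (E : L) (α : Fin P.nl → L) (F : L) (β : Fin P.nl → L) (ξ : Fin P.nst → L)
    (X : Fin P.nX → L) : RLVar P.nl P.nst P.nX → L
  | .root => E
  | .last => F
  | .src j => α j
  | .dst j => β j
  | .stat j => ξ j
  | .ex j => X j

/-- Values of the set variables of the rule. -/
def sval (α β : Fin P.ns → Finset ℤ) (S : Fin P.nS → Finset ℤ) : RSVar P.ns P.nS → Finset ℤ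
  | .src j => α j
  | .dst j => β j
  | .ex j => S j

/-- The heaps of `P(E, α; F, β; ξ)`: the least fixed point of the base rule and the inductive
rule. -/
inductive Sem {L : Type*} (F : L) (βL : Fin P.nl → L) (βS : Fin P.ns → Finset ℤ)
    (ξ : Fin P.nst → L) :
    Heap L 𝔽 𝔻 → L → (Fin P.nl → L) → (Fin P.ns → Finset ℤ) → Prop
  | base (h : Heap L 𝔽 𝔻) : h.ldom = ∅ → Sem F βL βS ξ h F βL βS
  | step (h h₁ h₂ : Heap L 𝔽 𝔻) (E : L) (αL : Fin P.nl → L) (αS : Fin P.ns → Finset ℤ)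
      (X : Fin P.nX → L) (S : Fin P.nS → Finset ℤ) :
      h.IsUnion h₁ h₂ →
      P.φ.Sat (P.sval αS βS S) →
      h₁.PointsTo E P.ρ (P.lval E αL F βL ξ X) Empty.elim (P.sval αS βS S) →
      Sem F βL βS ξ h₂ (P.lval E αL F βL ξ X P.Y)
        (fun i => P.lval E αL F βL ξ X (P.γL i)) (fun i => P.sval αS βS S (P.γS i)) →
      Sem F βL βS ξ h E αL αS

open Classical in
/-- The replacement of `dt(γ)` by `dt(β)`. -/
noncomputable def γToβ (v : RSVar P.ns P.nS) : RSVar P.ns P.nS :=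
  if h : ∃ j, P.γS j = v then .dst h.choose else v

/-- The extracted data constraint `φ_P(dt(α), dt(β)) = φ[dt(β)/dt(γ)]`. -/
noncomputable def φP : DBS (RSVar P.ns P.nS) := P.φ.subst P.γToβ

/-- The set relation defined by `φ_P(dt(α), dt(β))` (in which no existential variable is left, so
that the value given to these is immaterial). -/
def dataRel (A B : Fin P.ns → Finset ℤ) : Prop := P.φP.Sat (P.sval A B fun _ => ∅)

open Classical in
/-- The index `j` with `γ_j = E`, if `E` occurs in `γ`. -/
noncomputable def idx : Option (Fin P.nl) :=
  if h : ∃ j, P.γL j = RLVar.root then some h.choose else none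

/-- Data terms of the rule are defined: values of the set parameters that satisfy the data
constraint can be completed by values of the existential set variables outside `γ` for which all the
data terms of `ρ` are defined. -/
def DataGuarded : Prop :=
  ∀ (A B : Fin P.ns → Finset ℤ) (S : Fin P.nS → Finset ℤ), P.φ.Sat (P.sval A B S) →
    ∃ S' : Fin P.nS → Finset ℤ, (∀ i, P.sval A B S' (P.γS i) = P.sval A B S (P.γS i)) ∧
      RhoDefined P.ρ Empty.elim (P.sval A B S')

end IndPred

/-! ### Formulae of separation logic -/

/-- Assignments of locations, integers and finite sets of integers to variables. -/
structure Assign (L LV IV SV : Type*) where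
  loc : LV → L
  int : IV → ℤ
  set : SV → Finset ℤ

/-- Pure atoms `E = F` and `E ≠ F`. -/
inductive PureAtom (LV : Type*)
  | eq : LV → LV → PureAtom LV
  | ne : LV → LV → PureAtom LV

def PureAtom.Sat {L LV : Type*} (sl : LV → L) : PureAtom LV → Prop
  | .eq E F => sl E = sl F
  | .ne E F => sl E ≠ sl F

section
variable {𝔽 𝔻 : Type*}

/-- Points-to atoms `E ↦ (ρ)` and predicate atoms `P(Z₁, μ; Z₂, ν; χ)`; the tuples `μ` and `ν` are
split into locations and sets. -/
inductive Atom (P : IndPred 𝔽 𝔻) (LV IV SV : Type*)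
  | pointsTo (E : LV) (ρ : List (Entry 𝔽 𝔻 LV IV SV)) : Atom P LV IV SV
  | pred (Z₁ : LV) (μL : Fin P.nl → LV) (μS : Fin P.ns → SV)
      (Z₂ : LV) (νL : Fin P.nl → LV) (νS : Fin P.ns → SV) (χ : Fin P.nst → LV) : Atom P LV IV SV

/-- Spatial formulae. -/
inductive Spatial (P : IndPred 𝔽 𝔻) (LV IV SV : Type*)
  | emp : Spatial P LV IV SV
  | atom : Atom P LV IV SV → Spatial P LV IV SV
  | star : Spatial P LV IV SV → Spatial P LV IV SV → Spatial P LV IV SV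

/-- Formulae `Π ∧ Δ ∧ Σ` over the predicate `P`. -/
structure Formula (P : IndPred 𝔽 𝔻) (LV IV SV : Type*) where
  pure : List (PureAtom LV)
  data : PS IV SV
  spatial : Spatial P LV IV SV

variable {P : IndPred 𝔽 𝔻} {L LV IV SV : Type*}

def Atom.Sat (s : Assign L LV IV SV) (h : Heap L 𝔽 𝔻) : Atom P LV IV SV → Prop
  | .pointsTo E ρ => h.PointsTo (s.loc E) ρ s.loc s.int s.set
  | .pred Z₁ μL μS Z₂ νL νS χ =>
      P.Sem (s.loc Z₂) (s.loc ∘ νL) (s.set ∘ νS) (s.loc ∘ χ) h (s.loc Z₁) (s.loc ∘ μL) (s.set ∘ μS)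

def Spatial.Sat (s : Assign L LV IV SV) : Heap L 𝔽 𝔻 → Spatial P LV IV SV → Prop
  | h, .emp => h.ldom = ∅
  | h, .atom a => a.Sat s h
  | h, .star T₁ T₂ => ∃ h₁ h₂, h.IsUnion h₁ h₂ ∧ Spatial.Sat s h₁ T₁ ∧ Spatial.Sat s h₂ T₂

/-- The points-to and predicate atoms `a₁, …, aₙ` of a spatial formula. -/
def Spatial.atoms : Spatial P LV IV SV → List (Atom P LV IV SV)
  | .emp => []
  | .atom a => [a]
  | .star T₁ T₂ => T₁.atoms ++ T₂.atoms

namespace Formula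

/-- The state `(s, h)` satisfies the formula. -/
def Sat (s : Assign L LV IV SV) (h : Heap L 𝔽 𝔻) (φ : Formula P LV IV SV) : Prop :=
  (∀ p ∈ φ.pure, p.Sat s.loc) ∧ φ.data.Sat s.int s.set ∧ φ.spatial.Sat s h

/-- Satisfiability over the set `L` of locations. -/
def Satisfiable (L : Type*) (φ : Formula P LV IV SV) : Prop :=
  ∃ (s : Assign L LV IV SV) (h : Heap L 𝔽 𝔻), φ.Sat s h

/-- The fields of each points-to atom are pairwise distinct, and are those of `P`. -/
def WellFormed (φ : Formula P LV IV SV) : Prop :=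
  ∀ E ρ, Atom.pointsTo E ρ ∈ φ.spatial.atoms →
    (ρ.map Entry.field).Nodup ∧ fieldSet ρ = fieldSet P.ρ

/-- All data terms in points-to atoms of the formula are defined. -/
def DataDefined (φ : Formula P LV IV SV) (si : IV → ℤ) (ss : SV → Finset ℤ) : Prop :=
  ∀ E ρ, Atom.pointsTo E ρ ∈ φ.spatial.atoms → RhoDefined ρ si ss

/-- The data formula ensures that all data terms in points-to atoms are defined. -/
def DataGuarded (φ : Formula P LV IV SV) : Prop :=
  ∀ (si : IV → ℤ) (ss : SV → Finset ℤ), φ.data.Sat si ss → φ.DataDefined si ss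

end Formula

/-! ### The abstraction -/

/-- The variables `V` of the formula together with the fresh variables `γ₁` and `γ₂` (tuples of
length `n`) used for the `i`-th spatial atom. -/
inductive AVar (V : Type*) (n : ℕ)
  | orig : V → AVar V n
  | γ₁ : ℕ → Fin n → AVar V n
  | γ₂ : ℕ → Fin n → AVar V n

/-- Formulae of the abstraction. `bool Z i` is the Boolean variable `[Z, i]`; `phi A B` and `tc A B`
are the instances of `φ_P` and of `TC[φ_P]` with `A` for `dt(α)` and `B` for `dt(β)`. -/
inductive AForm (P : IndPred 𝔽 𝔻) (LV IV SV : Type*)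
  | tru : AForm P LV IV SV
  | bool : LV → ℕ → AForm P LV IV SV
  | locEq : AVar LV P.nl → AVar LV P.nl → AForm P LV IV SV
  | setEq : SV → SV → AForm P LV IV SV
  | data : PS IV SV → AForm P LV IV SV
  | phi : (Fin P.ns → AVar SV P.ns) → (Fin P.ns → AVar SV P.ns) → AForm P LV IV SV
  | tc : (Fin P.ns → AVar SV P.ns) → (Fin P.ns → AVar SV P.ns) → AForm P LV IV SV
  | not : AForm P LV IV SV → AForm P LV IV SV
  | and : AForm P LV IV SV → AForm P LV IV SV → AForm P LV IV SV
  | or : AForm P LV IV SV → AForm P LV IV SV → AForm P LV IV SV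

/-- Assignments for formulae of the abstraction. -/
structure AAssign (P : IndPred 𝔽 𝔻) (L LV IV SV : Type*) where
  loc : AVar LV P.nl → L
  int : IV → ℤ
  set : AVar SV P.ns → Finset ℤ
  bool : LV → ℕ → Bool

namespace AForm

/-- Satisfaction; `TC[φ_P]` is the union of all powers `R^i`, `i ≥ 0`, of the relation `R` defined
by `φ_P`. -/
def Sat (v : AAssign P L LV IV SV) : AForm P LV IV SV → Prop
  | .tru => True
  | .bool Z i => v.bool Z i = true
  | .locEq E F => v.loc E = v.loc F
  | .setEq S T => v.set (.orig S) = v.set (.orig T)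
  | .data Δ => Δ.Sat v.int (fun S => v.set (.orig S))
  | .phi A B => P.dataRel (v.set ∘ A) (v.set ∘ B)
  | .tc A B => Relation.ReflTransGen P.dataRel (v.set ∘ A) (v.set ∘ B)
  | .not Φ => ¬ Φ.Sat v
  | .and Φ Ψ => Φ.Sat v ∧ Ψ.Sat v
  | .or Φ Ψ => Φ.Sat v ∨ Ψ.Sat v

def Satisfiable (L : Type*) (Φ : AForm P LV IV SV) : Prop :=
  ∃ v : AAssign P L LV IV SV, Φ.Sat v

/-- Finite conjunctions. -/
def conj (l : List (AForm P LV IV SV)) : AForm P LV IV SV := l.foldr .and .tru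

def imp (Φ Ψ : AForm P LV IV SV) : AForm P LV IV SV := .or (.not Φ) Ψ

end AForm

/-- A pure atom as a formula of the abstraction. -/
def PureAtom.toAForm : PureAtom LV → AForm P LV IV SV
  | .eq E F => .locEq (.orig E) (.orig F)
  | .ne E F => .not (.locEq (.orig E) (.orig F))

/-- `Ufld₁` of the predicate atom `P(Z₁, μ; Z₂, ν; χ)`. -/
noncomputable def ufld₁ (Z₁ : LV) (μS : Fin P.ns → SV) (νL : Fin P.nl → LV) (νS : Fin P.ns → SV) :
    AForm P LV IV SV :=
  let φP : AForm P LV IV SV := .phi (fun k => .orig (μS k)) (fun k => .orig (νS k))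
  match P.idx with
  | some j => .and (.locEq (.orig Z₁) (.orig (νL j))) φP
  | none => φP

/-- `Ufld_{≥ 2}` of the `i`-th spatial atom, when this is the predicate atom
`P(Z₁, μ; Z₂, ν; χ)`. -/
noncomputable def ufldGe2 (i : ℕ) (Z₁ : LV) (μS : Fin P.ns → SV) (νL : Fin P.nl → LV)
    (νS : Fin P.ns → SV) : AForm P LV IV SV :=
  let chain : AForm P LV IV SV :=
    .and (.phi (fun k => .orig (μS k)) (.γ₁ i))
      (.and (.phi (.γ₁ i) (.γ₂ i)) (.tc (.γ₂ i) (fun k => .orig (νS k))))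
  match P.idx with
  | some j => .and (.not (.locEq (.orig Z₁) (.orig (νL j))))
      (.and (.not (.locEq (.orig Z₁) (.γ₂ i j))) chain)
  | none => chain

/-- The locations `Z` of the Boolean variables `[Z, i]` introduced for the `i`-th atom: the root
and, for a predicate atom with `E` in `γ`, the variable `ν_j` with `γ_j = E`. -/
noncomputable def Atom.boolLocs : Atom P LV IV SV → List LV
  | .pointsTo E _ => [E]
  | .pred Z₁ _ _ _ νL _ _ =>
    match P.idx with
    | some j => [Z₁, νL j]
    | none => [Z₁]

/-- The abstraction of the `i`-th spatial atom. -/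
noncomputable def Atom.abs (i : ℕ) : Atom P LV IV SV → AForm P LV IV SV
  | .pointsTo E _ => .bool E i
  | .pred Z₁ μL μS Z₂ νL νS χ =>
    let nonempty : AForm P LV IV SV := AForm.conj
      ((Atom.boolLocs (.pred Z₁ μL μS Z₂ νL νS χ : Atom P LV IV SV)).map fun Z => .bool Z i)
    .or
      (.and (.locEq (.orig Z₁) (.orig Z₂))
        (.and (AForm.conj (List.ofFn fun k => .locEq (.orig (μL k)) (.orig (νL k))))
          (AForm.conj (List.ofFn fun k => .setEq (μS k) (νS k)))))
      (.or (.and nonempty (ufld₁ Z₁ μS νL νS)) (.and nonempty (ufldGe2 i Z₁ μS νL νS)))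

/-- The Boolean variables `[Z, i]` of the formula, as pairs `(Z, i)`. -/
noncomputable def Spatial.boolVars (Sg : Spatial P LV IV SV) : List (LV × ℕ) :=
  Sg.atoms.zipIdx.flatMap fun a => a.1.boolLocs.map fun Z => (Z, a.2)

/-- `φ_Σ`, the conjunction of the abstractions of the atoms. -/
noncomputable def Spatial.absAtoms (Sg : Spatial P LV IV SV) : AForm P LV IV SV :=
  AForm.conj (Sg.atoms.zipIdx.map fun a => a.1.abs a.2)

/-- `φ_*`, which encodes separating conjunction: for all Boolean variables `[Z, i]`, `[Z', j]`
with `i ≠ j`, the conjunct `(Z = Z' ∧ [Z, i]) → ¬ [Z', j]`. -/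
noncomputable def Spatial.absStar (Sg : Spatial P LV IV SV) : AForm P LV IV SV :=
  AForm.conj (Sg.boolVars.flatMap fun b => (Sg.boolVars.filter fun c => b.2 ≠ c.2).map fun c =>
    AForm.imp (.and (.locEq (.orig b.1) (.orig c.1)) (.bool b.1 b.2)) (.not (.bool c.1 c.2)))

/-- The abstraction `Abs(φ) = Π ∧ Δ ∧ φ_Σ ∧ φ_*`. -/
noncomputable def Formula.abs (φ : Formula P LV IV SV) : AForm P LV IV SV :=
  .and (AForm.conj (φ.pure.map PureAtom.toAForm))
    (.and (.data φ.data) (.and φ.spatial.absAtoms φ.spatial.absStar))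

end

end SLID

/-!
A heap of the predicate `P` is a chain of cells, and the heap constraint can be separated from the
data constraint: by `c1_φ` and `c3` the rule's constraint `φ` only relates the source sets `α` to the
sets in `γ`, so that `n` unfoldings exist on the data side iff the source and destination sets are
related by the `n`-th power of `φ_P` (`IndPred.LinearlyCompositional.dataRel_iff`).

On the location side a nonempty chain allocates its root `Z₁`, and if `γ_j = E` for some `j` then it
also allocates `ν_j`, which is the root of its last cell. For one unfolding these two roots coincide;
for more they differ, because cells are disjoint. This gives the necessity of the abstraction
(`IndPred.Sem.cases_unfold`), with `[Z, i]` read as "`Z` is allocated in the heap of the `i`-th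
atom".

Conversely, `c4_loc` and `c6_loc` leave the roots and location parameters of the intermediate
cells free. Since there are infinitely many locations, the intermediate cells can be put outside any
given finite set; the first and the last cell are at `Z₁` and `ν_j`, whose Boolean variables the
abstraction forces to be true, or, if no `γ_j` is `E`, only the first cell is fixed
(`IndPred.LinearlyCompositional.exists_sem_of_transGen`). Guardedness provides data values for the
cells. The heaps of the atoms are then chosen one after the other: fixed cells of different atoms are
separated by the conjunct `φ_*` of the abstraction, and all other cells are fresh
(`Spatial.exists_heap_of_atoms`). All heaps constructed have exactly the fields of `P`, so that their
unions are field-consistent.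
-/

namespace SLID

/-! ### Substitution and coincidence for difference-bound set formulae -/

section
variable {SV SV' : Type*}

theorem DTerm.eval_subst (f : SV → SV') (ss : SV' → Finset ℤ) (t : DTerm SV) :
    (t.subst f).eval ss = t.eval (ss ∘ f) := by
  cases t <;> rfl

theorem DSTerm.eval_subst (f : SV → SV') (ss : SV' → Finset ℤ) (t : DSTerm SV) :
    (t.subst f).eval ss = t.eval (ss ∘ f) := by
  induction t with
  | empty => rfl
  | single t => simp [DSTerm.subst, DSTerm.eval, DTerm.eval_subst]
  | union t u iht ihu => simp [DSTerm.subst, DSTerm.eval, iht, ihu]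

theorem DAtom.sat_subst (f : SV → SV') (ss : SV' → Finset ℤ) (a : DAtom SV) :
    (a.subst f).Sat ss ↔ a.Sat (ss ∘ f) := by
  cases a <;> simp [DAtom.subst, DAtom.Sat, DTerm.eval_subst, DSTerm.eval_subst]

theorem DBS.sat_subst (f : SV → SV') (ss : SV' → Finset ℤ) (φ : DBS SV) :
    (φ.subst f).Sat ss ↔ φ.Sat (ss ∘ f) := by
  simp [DBS.Sat, DBS.subst, DAtom.sat_subst]

theorem DTerm.eval_congr {ss ss' : SV → Finset ℤ} {t : DTerm SV}
    (h : ∀ v ∈ t.vars, ss v = ss' v) : t.eval ss = t.eval ss' := by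
  cases t <;> simp_all [DTerm.eval, DTerm.vars]

theorem DSTerm.eval_congr {ss ss' : SV → Finset ℤ} {t : DSTerm SV}
    (h : ∀ v ∈ t.vars, ss v = ss' v) : t.eval ss = t.eval ss' := by
  induction t with
  | empty => rfl
  | single t => simp only [DSTerm.eval, DTerm.eval_congr h]
  | union t u iht ihu =>
    simp only [DSTerm.vars, List.mem_append] at h
    simp only [DSTerm.eval, iht fun v hv => h v (.inl hv), ihu fun v hv => h v (.inr hv)]

theorem DAtom.sat_congr {ss ss' : SV → Finset ℤ} {a : DAtom SV}
    (h : ∀ v ∈ a.vars, ss v = ss' v) : a.Sat ss ↔ a.Sat ss' := by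
  cases a with
  | set S S' t =>
    simp only [DAtom.vars, List.mem_cons] at h
    simp only [DAtom.Sat, h S (.inl rfl), h S' (.inr (.inl rfl)),
      DSTerm.eval_congr fun v hv => h v (.inr (.inr hv))]
  | diff t r u c =>
    simp only [DAtom.vars, List.mem_append] at h
    simp only [DAtom.Sat, DTerm.eval_congr fun v hv => h v (.inl hv),
      DTerm.eval_congr fun v hv => h v (.inr hv)]

end

/-! ### The data relation of a linearly compositional predicate -/

namespace IndPred
variable {𝔽 𝔻 : Type*} {P : IndPred 𝔽 𝔻}

theorem LinearlyCompositional.γS_injective (hP : P.LinearlyCompositional) :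
    Function.Injective P.γS :=
  List.nodup_ofFn.1 hP.c4_set.of_append_left

theorem LinearlyCompositional.γL_injective (hP : P.LinearlyCompositional) :
    Function.Injective P.γL :=
  List.nodup_ofFn.1 (List.nodup_cons.1 hP.c4_loc).2.of_append_left

theorem LinearlyCompositional.Y_ne_γL (hP : P.LinearlyCompositional) (i : Fin P.nl) :
    P.Y ≠ P.γL i := by
  intro h
  exact (List.nodup_cons.1 hP.c4_loc).1
    (List.mem_append_left _ (by simpa [List.mem_ofFn] using ⟨i, h.symm⟩))

/-- Up to the choice of values for the variables that do not occur in it, the constraint of the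
rule is the relation `φ_P` between the source sets and the values of `γ`: by `c1_φ` and `c3`, the
constraint mentions no other variables. -/
theorem LinearlyCompositional.dataRel_iff (hP : P.LinearlyCompositional)
    {A B C : Fin P.ns → Finset ℤ} {S : Fin P.nS → Finset ℤ}
    (hS : ∀ i, P.sval A C S (P.γS i) = B i) :
    P.dataRel A B ↔ P.φ.Sat (P.sval A C S) := by
  unfold dataRel φP
  rw [DBS.sat_subst]
  refine forall₂_congr fun a ha => DAtom.sat_congr fun v hv => ?_
  obtain ⟨i, hi⟩ := hP.c3 a ha
  have hex : ∃ j, P.γS j = P.γS i := ⟨i, rfl⟩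
  rcases hi v hv with rfl | rfl
  · have hn : ¬ ∃ j, P.γS j = RSVar.src i := by
      rintro ⟨j, hj⟩
      obtain ⟨k, hk⟩ := hP.c6_set j
      rw [hk] at hj
      cases hj
    simp [γToβ, hn, sval]
  · have hc : hex.choose = i := hP.γS_injective hex.choose_spec
    rw [Function.comp_apply, hS, γToβ, dif_pos hex, hc]
    rfl

theorem LinearlyCompositional.idx_eq_some_iff (hP : P.LinearlyCompositional) {j : Fin P.nl} :
    P.idx = some j ↔ P.γL j = RLVar.root := by
  unfold idx
  split_ifs with h
  · rw [Option.some_inj]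
    constructor
    · rintro rfl
      exact h.choose_spec
    · intro hj
      exact hP.γL_injective (h.choose_spec.trans hj.symm)
  · simp only [false_iff]
    exact fun hj => h ⟨j, hj⟩

end IndPred

/-! ### Heaps with a fixed set of fields -/

section
variable {L 𝔽 𝔻 LV IV SV : Type*}

/-- Every allocated location of the heap has exactly the fields in `R`. -/
def Heap.HasFields (h : Heap L 𝔽 𝔻) (R : Set (𝔽 ⊕ 𝔻)) : Prop :=
  ∀ l ∈ h.ldom, (∀ f, (h.loc l f).isSome ↔ Sum.inl f ∈ R) ∧
    ∀ d, (h.dat l d).isSome ↔ Sum.inr d ∈ R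

/-- The empty heap. -/
def Heap.empty : Heap L 𝔽 𝔻 where
  loc _ _ := none
  dat _ _ := none
  consistent := by simp

@[simp] theorem Heap.ldom_empty : (Heap.empty : Heap L 𝔽 𝔻).ldom = ∅ := by
  ext
  simp [Heap.ldom, Heap.empty]

theorem Heap.hasFields_empty (R : Set (𝔽 ⊕ 𝔻)) : (Heap.empty : Heap L 𝔽 𝔻).HasFields R := by
  simp [Heap.HasFields]

theorem Heap.HasFields.flds_eq {h : Heap L 𝔽 𝔻} {R : Set (𝔽 ⊕ 𝔻)} (hR : h.HasFields R)
    (hne : h.ldom ≠ ∅) : h.flds = R := by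
  obtain ⟨l, hl⟩ := Set.nonempty_iff_ne_empty.2 hne
  ext (f | d)
  · constructor
    · rintro ⟨l', hl'⟩
      exact ((hR l' (Or.inl ⟨f, hl'⟩)).1 f).1 hl'
    · exact fun hf => ⟨l, ((hR l hl).1 f).2 hf⟩
  · constructor
    · rintro ⟨l', hl'⟩
      exact ((hR l' (Or.inr ⟨d, hl'⟩)).2 d).1 hl'
    · exact fun hd => ⟨l, ((hR l hl).2 d).2 hd⟩

theorem Heap.IsUnion.ldom_eq {h h₁ h₂ : Heap L 𝔽 𝔻} (hu : h.IsUnion h₁ h₂) :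
    h.ldom = h₁.ldom ∪ h₂.ldom := by
  ext l
  simp only [Heap.ldom, Set.mem_ofPred_eq, Set.mem_union, hu.2.2.1, hu.2.2.2, Option.isSome_or,
    Bool.or_eq_true, exists_or]
  tauto

theorem Heap.loc_eq_none {h : Heap L 𝔽 𝔻} {l : L} (hl : l ∉ h.ldom) (f : 𝔽) :
    h.loc l f = none := by
  by_contra hc
  exact hl (Or.inl ⟨f, Option.isSome_iff_ne_none.2 hc⟩)

theorem Heap.dat_eq_none {h : Heap L 𝔽 𝔻} {l : L} (hl : l ∉ h.ldom) (d : 𝔻) :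
    h.dat l d = none := by
  by_contra hc
  exact hl (Or.inr ⟨d, Option.isSome_iff_ne_none.2 hc⟩)

/-- Heaps with the same fields and disjoint sets of allocated locations have a union. -/
theorem Heap.HasFields.exists_isUnion {h₁ h₂ : Heap L 𝔽 𝔻} {R : Set (𝔽 ⊕ 𝔻)}
    (hR₁ : h₁.HasFields R) (hR₂ : h₂.HasFields R) (hd : Disjoint h₁.ldom h₂.ldom) :
    ∃ h : Heap L 𝔽 𝔻, h.IsUnion h₁ h₂ ∧ h.HasFields R := by
  have key : ∀ l, ((∃ f, ((h₁.loc l f).or (h₂.loc l f)).isSome) ∨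
      ∃ d, ((h₁.dat l d).or (h₂.dat l d)).isSome) →
      (∀ f, ((h₁.loc l f).or (h₂.loc l f)).isSome ↔ Sum.inl f ∈ R) ∧
        ∀ d, ((h₁.dat l d).or (h₂.dat l d)).isSome ↔ Sum.inr d ∈ R := by
    intro l hl
    by_cases h1 : l ∈ h₁.ldom
    · have h2 : l ∉ h₂.ldom := Set.disjoint_left.1 hd h1
      simpa [Heap.loc_eq_none h2, Heap.dat_eq_none h2] using hR₁ l h1
    · simp only [Heap.loc_eq_none h1, Heap.dat_eq_none h1, Option.none_or] at hl ⊢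
      exact hR₂ l hl
  refine ⟨⟨fun l f => (h₁.loc l f).or (h₂.loc l f), fun l d => (h₁.dat l d).or (h₂.dat l d),
    fun l l' hl hl' => ⟨fun f => ((key l hl).1 f).trans ((key l' hl').1 f).symm,
      fun d => ((key l hl).2 d).trans ((key l' hl').2 d).symm⟩⟩,
    ⟨hd, ?_, fun _ _ => rfl, fun _ _ => rfl⟩, key⟩
  by_cases e₁ : h₁.ldom = ∅
  · exact .inl e₁
  by_cases e₂ : h₂.ldom = ∅
  · exact .inr (.inl e₂)
  · exact .inr (.inr ((hR₁.flds_eq e₁).trans (hR₂.flds_eq e₂).symm))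

open Classical in
/-- A single cell satisfying a points-to atom, if the fields are distinct and the data terms are
defined. -/
theorem exists_pointsTo {ρ : List (Entry 𝔽 𝔻 LV IV SV)} (hf : (ρ.map Entry.field).Nodup)
    (hne : ρ ≠ []) (l : L) (sl : LV → L) (si : IV → ℤ) (ss : SV → Finset ℤ)
    (hρ : RhoDefined ρ si ss) :
    ∃ h : Heap L 𝔽 𝔻, h.PointsTo l ρ sl si ss ∧ h.HasFields (fieldSet ρ) := by
  let lc : L → 𝔽 → Option L := fun l' f =>
    if h : l' = l ∧ ∃ X, Entry.loc f X ∈ ρ then some (sl h.2.choose) else none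
  let dt : L → 𝔻 → Option ℤ := fun l' d =>
    if h : l' = l ∧ ∃ t, Entry.dat d t ∈ ρ then h.2.choose.eval si ss else none
  have hlc : ∀ l' f, (lc l' f).isSome ↔ l' = l ∧ Sum.inl f ∈ fieldSet ρ := by
    intro l' f
    have he : (∃ X, Entry.loc f X ∈ ρ) ↔ Sum.inl f ∈ fieldSet ρ := by
      constructor
      · rintro ⟨X, hX⟩
        exact ⟨_, hX, rfl⟩
      · rintro ⟨e | e, he, heq⟩ <;> simp only [Entry.field, reduceCtorEq, Sum.inl.injEq] at heq
        subst heq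
        exact ⟨_, he⟩
    rw [← he]
    simp only [lc]
    split_ifs with h <;> simp [h]
  have hdt : ∀ l' d, (dt l' d).isSome ↔ l' = l ∧ Sum.inr d ∈ fieldSet ρ := by
    intro l' d
    have he : (∃ t, Entry.dat d t ∈ ρ) ↔ Sum.inr d ∈ fieldSet ρ := by
      constructor
      · rintro ⟨t, ht⟩
        exact ⟨_, ht, rfl⟩
      · rintro ⟨e | e, he, heq⟩ <;> simp only [Entry.field, reduceCtorEq, Sum.inr.injEq] at heq
        subst heq
        exact ⟨_, he⟩
    rw [← he]
    simp only [dt]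
    split_ifs with h
    · simp [h, hρ _ _ h.2.choose_spec]
    · simp [h]
  have hdom : ∀ l', ((∃ f, (lc l' f).isSome) ∨ ∃ d, (dt l' d).isSome) → l' = l := by
    rintro l' (⟨f, hf'⟩ | ⟨d, hd'⟩)
    · exact ((hlc l' f).1 hf').1
    · exact ((hdt l' d).1 hd').1
  refine ⟨⟨lc, dt, fun l₁ l₂ h₁ h₂ => ?_⟩, ⟨?_, ?_, ?_⟩, ?_⟩
  · rw [hdom _ h₁, hdom _ h₂]
    simp
  · ext l'
    refine ⟨hdom l', ?_⟩
    rintro rfl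
    obtain ⟨e, he⟩ := List.exists_mem_of_ne_nil ρ hne
    rcases e with ⟨f, X⟩ | ⟨d, t⟩
    · exact .inl ⟨f, (hlc _ f).2 ⟨rfl, _, he, rfl⟩⟩
    · exact .inr ⟨d, (hdt _ d).2 ⟨rfl, _, he, rfl⟩⟩
  · intro f X hX
    have h : l = l ∧ ∃ X, Entry.loc f X ∈ ρ := ⟨rfl, X, hX⟩
    have := List.inj_on_of_nodup_map hf h.2.choose_spec hX rfl
    simp only [Entry.loc.injEq, true_and] at this
    simp only [lc, dif_pos h, this]
  · intro d t ht
    have h : l = l ∧ ∃ t, Entry.dat d t ∈ ρ := ⟨rfl, t, ht⟩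
    have := List.inj_on_of_nodup_map hf h.2.choose_spec ht rfl
    simp only [Entry.dat.injEq, true_and] at this
    obtain ⟨n, hn⟩ := Option.isSome_iff_exists.1 (hρ d t ht)
    exact ⟨n, hn, by simp only [dt, dif_pos h, this, hn]⟩
  · intro l' hl'
    have := hdom l' hl'
    exact ⟨fun f => by simp [hlc, this], fun d => by simp [hdt, this]⟩

end

/-! ### Necessary conditions for a predicate atom -/

namespace IndPred
variable {𝔽 𝔻 L : Type*} {P : IndPred 𝔽 𝔻} {F : L} {βL : Fin P.nl → L}
  {βS : Fin P.ns → Finset ℤ} {ξ : Fin P.nst → L}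

/-- A heap of the predicate is empty, or else it allocates the root and, if `E` occurs in `γ`, also
the corresponding destination parameter, which is the root of the last cell. -/
theorem Sem.root_mem_ldom (hP : P.LinearlyCompositional) {h : Heap L 𝔽 𝔻} {E : L}
    {αL : Fin P.nl → L} {αS : Fin P.ns → Finset ℤ} (hs : P.Sem F βL βS ξ h E αL αS) :
    (h.ldom = ∅ ∧ E = F ∧ αL = βL ∧ αS = βS) ∨
      (E ∈ h.ldom ∧ ∀ j, P.idx = some j → βL j ∈ h.ldom) := by
  induction hs with
  | base h hd => exact .inl ⟨hd, rfl, rfl, rfl⟩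
  | step h h₁ h₂ E αL αS X S hu hφ hp _ ih =>
    have hE : E ∈ h.ldom := by simp [hu.ldom_eq, hp.1]
    refine .inr ⟨hE, fun j hj => ?_⟩
    rcases ih with ⟨-, -, hL, -⟩ | ⟨-, h₂j⟩
    · rw [← congrFun hL j, hP.idx_eq_some_iff.1 hj]
      exact hE
    · rw [hu.ldom_eq]
      exact .inr (h₂j j hj)

theorem Sem.reflTransGen_dataRel (hP : P.LinearlyCompositional) {h : Heap L 𝔽 𝔻} {E : L}
    {αL : Fin P.nl → L} {αS : Fin P.ns → Finset ℤ} (hs : P.Sem F βL βS ξ h E αL αS) :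
    Relation.ReflTransGen P.dataRel αS βS := by
  induction hs with
  | base => exact .refl
  | step h h₁ h₂ E αL αS X S hu hφ hp _ ih => exact .head ((hP.dataRel_iff fun _ => rfl).2 hφ) ih

/-- The three disjuncts of the abstraction of a predicate atom: no unfolding of the inductive rule,
exactly one, or at least two. In the last case `γ₁`, `γ₂` are the source parameters after the first
and the second unfolding. -/
theorem Sem.cases_unfold (hP : P.LinearlyCompositional) {h : Heap L 𝔽 𝔻} {E : L}
    {αL : Fin P.nl → L} {αS : Fin P.ns → Finset ℤ} (hs : P.Sem F βL βS ξ h E αL αS) :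
    (E = F ∧ αL = βL ∧ αS = βS) ∨
      (E ∈ h.ldom ∧ ∀ j, P.idx = some j → βL j ∈ h.ldom) ∧
        ((P.dataRel αS βS ∧ ∀ j, P.idx = some j → E = βL j) ∨
          ∃ (γL : Fin P.nl → L) (γ₁ γ₂ : Fin P.ns → Finset ℤ),
            (∀ j, P.idx = some j → E ≠ βL j ∧ E ≠ γL j) ∧
            P.dataRel αS γ₁ ∧ P.dataRel γ₁ γ₂ ∧ Relation.ReflTransGen P.dataRel γ₂ βS) := by
  rcases hs.root_mem_ldom hP with ⟨-, h0⟩ | hmem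
  · exact .inl h0
  cases hs with
  | base => exact .inl ⟨rfl, rfl, rfl⟩
  | step _ h₁ h₂ _ _ _ X S hu hφ hp hs₂ =>
    refine .inr ⟨hmem, ?_⟩
    have hrel := (hP.dataRel_iff (B := fun i => P.sval αS βS S (P.γS i)) fun _ => rfl).2 hφ
    have hE : E ∉ h₂.ldom := Set.disjoint_left.1 hu.1 (by simp [hp.1])
    have hroot := hs₂.root_mem_ldom hP
    generalize P.lval E αL F βL ξ X P.Y = E' at hs₂ hroot
    generalize hα' : (fun i => P.lval E αL F βL ξ X (P.γL i)) = αL' at hs₂ hroot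
    generalize (fun i => P.sval αS βS S (P.γS i)) = αS' at hs₂ hrel hroot
    have hγ : ∀ j, P.idx = some j → E = αL' j := by
      intro j hj
      rw [← congrFun hα' j, hP.idx_eq_some_iff.1 hj]
      rfl
    cases hs₂ with
    | base => exact .inl ⟨hrel, hγ⟩
    | step _ h₁' h₂' _ _ _ X' S' hu' hφ' hp' hs₃ =>
      have hE'mem : E' ∈ h₂.ldom := by simp [hu'.ldom_eq, hp'.1]
      have hmem₂ : ∀ j, P.idx = some j → βL j ∈ h₂.ldom := by
        rcases hroot with ⟨h0, -⟩ | hr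
        · simp [h0] at hE'mem
        · exact hr.2
      refine .inr ⟨fun i => P.lval E' αL' F βL ξ X' (P.γL i), _, _, fun j hj => ⟨?_, ?_⟩, hrel,
        (hP.dataRel_iff fun _ => rfl).2 hφ', hs₃.reflTransGen_dataRel hP⟩
      · rintro rfl
        exact hE (hmem₂ j hj)
      · simp only [hP.idx_eq_some_iff.1 hj]
        rintro (rfl : E = E')
        exact hE hE'mem

/-! ### Construction of heaps of the predicate -/

theorem LinearlyCompositional.ρ_ne_nil (hP : P.LinearlyCompositional) : P.ρ ≠ [] := by
  obtain ⟨j, -⟩ := hP.c6_Y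
  intro h
  simpa [h] using hP.c5_ex j

/-- One more unfolding of the inductive rule. By the linearity of the rule the root and the source parameters
of the remaining heap may be prescribed, except that the parameter `γ_j = E`, if there is one, has
to be the new root. -/
theorem LinearlyCompositional.exists_sem_cons (hP : P.LinearlyCompositional) (hg : P.DataGuarded)
    {h₂ : Heap L 𝔽 𝔻} {E E' : L} {αL αL' : Fin P.nl → L} {A A' : Fin P.ns → Finset ℤ}
    (hs : P.Sem F βL βS ξ h₂ E' αL' A') (hf : h₂.HasFields (fieldSet P.ρ)) (hE : E ∉ h₂.ldom)
    (hrel : P.dataRel A A') (hidx : ∀ j, P.idx = some j → αL' j = E) :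
    ∃ h : Heap L 𝔽 𝔻, P.Sem F βL βS ξ h E αL A ∧ h.HasFields (fieldSet P.ρ) ∧
      h.ldom = insert E h₂.ldom := by
  classical
  -- `S₀` realizes `A'` on `γ`; guardedness then corrects the other variables, making `ρ` defined.
  let S₀ : Fin P.nS → Finset ℤ := fun k => Function.extend P.γS A' (fun _ => ∅) (.ex k)
  have hS₀ : ∀ i, P.sval A βS S₀ (P.γS i) = A' i := by
    intro i
    obtain ⟨k, hk⟩ := hP.c6_set i
    rw [hk]
    change Function.extend P.γS A' (fun _ => ∅) (.ex k) = A' i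
    rw [← hk, hP.γS_injective.extend_apply]
  obtain ⟨S, hS, hdef⟩ := hg A βS S₀ ((hP.dataRel_iff hS₀).1 hrel)
  replace hS : ∀ i, P.sval A βS S (P.γS i) = A' i := fun i => (hS i).trans (hS₀ i)
  let X : Fin P.nX → L := fun k =>
    if P.Y = .ex k then E' else Function.extend P.γL αL' (fun _ => E) (.ex k)
  have hY : P.lval E αL F βL ξ X P.Y = E' := by
    obtain ⟨k, hk⟩ := hP.c6_Y
    rw [hk]
    exact if_pos hk
  have hγ : ∀ i, P.lval E αL F βL ξ X (P.γL i) = αL' i := by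
    intro i
    rcases hP.c6_loc i with hk | ⟨k, hk⟩
    · rw [hk, hidx i (hP.idx_eq_some_iff.2 hk)]
      rfl
    · rw [hk]
      have hne : P.Y ≠ .ex k := hk ▸ hP.Y_ne_γL i
      change (if P.Y = .ex k then E' else Function.extend P.γL αL' (fun _ => E) (.ex k)) = αL' i
      rw [if_neg hne, ← hk, hP.γL_injective.extend_apply]
  obtain ⟨h₁, hp, hf₁⟩ := exists_pointsTo hP.fields hP.ρ_ne_nil E (P.lval E αL F βL ξ X)
    Empty.elim (P.sval A βS S) hdef
  obtain ⟨h, hu, hh⟩ := hf₁.exists_isUnion hf (by rw [hp.1]; exact Set.disjoint_singleton_left.2 hE)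
  refine ⟨h, .step h h₁ h₂ E αL A X S hu ((hP.dataRel_iff hS).1 hrel) hp ?_, hh, ?_⟩
  · rw [hY, funext hγ, funext hS]
    exact hs
  · rw [hu.ldom_eq, hp.1]
    rfl

theorem LinearlyCompositional.exists_sem_one (hP : P.LinearlyCompositional) (hg : P.DataGuarded)
    (F : L) (βL : Fin P.nl → L) (ξ : Fin P.nst → L) {E : L} (αL : Fin P.nl → L)
    {A : Fin P.ns → Finset ℤ} (hrel : P.dataRel A βS) (hidx : ∀ j, P.idx = some j → βL j = E) :
    ∃ h : Heap L 𝔽 𝔻, P.Sem F βL βS ξ h E αL A ∧ h.HasFields (fieldSet P.ρ) ∧ h.ldom = {E} := by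
  simpa using hP.exists_sem_cons hg (αL := αL) (Sem.base (P := P) (ξ := ξ) Heap.empty Heap.ldom_empty)
    (Heap.hasFields_empty _) (by simp) hrel hidx

/-- A chain of at least two instances of `φ_P` gives a heap whose first cell is `E`, whose last cell
is `t`, and whose intermediate cells avoid a given finite set. -/
theorem LinearlyCompositional.exists_sem_of_transGen [Infinite L] (hP : P.LinearlyCompositional)
    (hg : P.DataGuarded) (F : L) (βL : Fin P.nl → L) (ξ : Fin P.nst → L) {t : L}
    (ht : ∀ j, P.idx = some j → βL j = t) {A A' : Fin P.ns → Finset ℤ} (hrel : P.dataRel A A')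
    (hchain : Relation.TransGen P.dataRel A' βS) {E : L} (hE : E ≠ t) (αL : Fin P.nl → L)
    {W : Set L} (hW : W.Finite) :
    ∃ h : Heap L 𝔽 𝔻, P.Sem F βL βS ξ h E αL A ∧ h.HasFields (fieldSet P.ρ) ∧
      h.ldom.Finite ∧ h.ldom ⊆ {E, t} ∪ Wᶜ := by
  induction hchain using Relation.TransGen.head_induction_on generalizing A E αL W with
  | single hlast =>
    obtain ⟨h₂, hs, hf, hd⟩ := hP.exists_sem_one hg F βL ξ (fun _ => E) hlast ht
    obtain ⟨h, hs', hf', hd'⟩ := hP.exists_sem_cons hg (αL := αL) hs hf (by simpa [hd] using hE) hrel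
      fun _ _ => rfl
    rw [hd] at hd'
    exact ⟨h, hs', hf', by simp [hd'], by simp [hd']⟩
  | head hnext _ ih =>
    obtain ⟨E', hE'⟩ := (hW.union (Set.toFinite {E, t})).exists_notMem
    simp only [Set.mem_union, Set.mem_insert_iff, Set.mem_singleton_iff, not_or] at hE'
    obtain ⟨h₂, hs, hf, hfin, hd⟩ := ih hnext hE'.2.2 (fun _ => E) (hW.insert E)
    have hEmem : E ∉ h₂.ldom := by
      intro hmem
      rcases hd hmem with (h | h) | h
      · exact hE'.2.1 h.symm
      · exact hE h
      · exact h (Set.mem_insert _ _)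
    obtain ⟨h, hs', hf', hd'⟩ := hP.exists_sem_cons hg (αL := αL) hs hf hEmem hrel fun _ _ => rfl
    refine ⟨h, hs', hf', by simpa [hd'] using hfin.insert E, ?_⟩
    rw [hd']
    rintro l (rfl | hl)
    · simp
    · rcases hd hl with (rfl | h) | h
      · exact .inr hE'.1
      · exact .inl (.inr h)
      · exact .inr fun hlW => h (Set.mem_insert_of_mem _ hlW)

end IndPred

/-! ### Satisfaction of the abstraction -/

section
variable {𝔽 𝔻 L LV IV SV : Type*} {P : IndPred 𝔽 𝔻}

theorem AForm.sat_conj {v : AAssign P L LV IV SV} {l : List (AForm P LV IV SV)} :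
    (AForm.conj l).Sat v ↔ ∀ Φ ∈ l, Φ.Sat v := by
  induction l with
  | nil => simp [AForm.conj, AForm.Sat]
  | cons Φ l ih =>
    simp only [AForm.conj] at ih
    simp [AForm.conj, AForm.Sat, ih]

theorem PureAtom.sat_toAForm {v : AAssign P L LV IV SV} (p : PureAtom LV) :
    (p.toAForm : AForm P LV IV SV).Sat v ↔ p.Sat fun E => v.loc (.orig E) := by
  cases p <;> rfl

theorem Atom.mem_boolLocs_pred {Z₁ : LV} {μL : Fin P.nl → LV} {μS : Fin P.ns → SV} {Z₂ : LV}
    {νL : Fin P.nl → LV} {νS : Fin P.ns → SV} {χ : Fin P.nst → LV} {Z : LV} :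
    Z ∈ (Atom.pred Z₁ μL μS Z₂ νL νS χ : Atom P LV IV SV).boolLocs ↔
      Z = Z₁ ∨ ∃ j, P.idx = some j ∧ Z = νL j := by
  unfold Atom.boolLocs
  cases P.idx <;> simp

theorem Atom.sat_abs_pred {v : AAssign P L LV IV SV} {i : ℕ} {Z₁ : LV} {μL : Fin P.nl → LV}
    {μS : Fin P.ns → SV} {Z₂ : LV} {νL : Fin P.nl → LV} {νS : Fin P.ns → SV}
    {χ : Fin P.nst → LV} :
    ((Atom.pred Z₁ μL μS Z₂ νL νS χ : Atom P LV IV SV).abs i).Sat v ↔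
      (v.loc (.orig Z₁) = v.loc (.orig Z₂) ∧ (∀ k, v.loc (.orig (μL k)) = v.loc (.orig (νL k))) ∧
        ∀ k, v.set (.orig (μS k)) = v.set (.orig (νS k))) ∨
      (v.bool Z₁ i = true ∧ ∀ j, P.idx = some j → v.bool (νL j) i = true) ∧
        ((P.dataRel (fun k => v.set (.orig (μS k))) (fun k => v.set (.orig (νS k))) ∧
            ∀ j, P.idx = some j → v.loc (.orig Z₁) = v.loc (.orig (νL j))) ∨
          (∀ j, P.idx = some j → v.loc (.orig Z₁) ≠ v.loc (.orig (νL j)) ∧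
            v.loc (.orig Z₁) ≠ v.loc (.γ₂ i j)) ∧
          P.dataRel (fun k => v.set (.orig (μS k))) (fun k => v.set (.γ₁ i k)) ∧
          P.dataRel (fun k => v.set (.γ₁ i k)) (fun k => v.set (.γ₂ i k)) ∧
          Relation.ReflTransGen P.dataRel (fun k => v.set (.γ₂ i k))
            (fun k => v.set (.orig (νS k)))) := by
  have hb : (AForm.conj ((Atom.boolLocs (.pred Z₁ μL μS Z₂ νL νS χ : Atom P LV IV SV)).map
      fun Z => .bool Z i)).Sat v ↔
      v.bool Z₁ i = true ∧ ∀ j, P.idx = some j → v.bool (νL j) i = true := by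
    simp only [AForm.sat_conj, List.forall_mem_map, Atom.mem_boolLocs_pred, AForm.Sat]
    constructor
    · exact fun h => ⟨h _ (.inl rfl), fun j hj => h _ (.inr ⟨j, hj, rfl⟩)⟩
    · rintro h Z (rfl | ⟨j, hj, rfl⟩)
      exacts [h.1, h.2 j hj]
  have h1 : (ufld₁ Z₁ μS νL νS : AForm P LV IV SV).Sat v ↔
      P.dataRel (fun k => v.set (.orig (μS k))) (fun k => v.set (.orig (νS k))) ∧
        ∀ j, P.idx = some j → v.loc (.orig Z₁) = v.loc (.orig (νL j)) := by
    unfold ufld₁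
    cases P.idx with
    | none => simp [AForm.Sat, Function.comp_def]
    | some j => simp [AForm.Sat, Function.comp_def, and_comm]
  have h2 : (ufldGe2 i Z₁ μS νL νS : AForm P LV IV SV).Sat v ↔
      (∀ j, P.idx = some j → v.loc (.orig Z₁) ≠ v.loc (.orig (νL j)) ∧
        v.loc (.orig Z₁) ≠ v.loc (.γ₂ i j)) ∧
      P.dataRel (fun k => v.set (.orig (μS k))) (fun k => v.set (.γ₁ i k)) ∧
      P.dataRel (fun k => v.set (.γ₁ i k)) (fun k => v.set (.γ₂ i k)) ∧
      Relation.ReflTransGen P.dataRel (fun k => v.set (.γ₂ i k))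
        (fun k => v.set (.orig (νS k))) := by
    unfold ufldGe2
    cases P.idx with
    | none => simp [AForm.Sat, Function.comp_def]
    | some j => simp [AForm.Sat, Function.comp_def, and_assoc]
  simp only [Atom.abs, AForm.Sat, hb, h1, h2, AForm.sat_conj, List.forall_mem_ofFn_iff,
    ← and_or_left]

theorem Spatial.sat_absStar {v : AAssign P L LV IV SV} {T : Spatial P LV IV SV} :
    T.absStar.Sat v ↔ ∀ a i b j, (a, i) ∈ T.atoms.zipIdx → (b, j) ∈ T.atoms.zipIdx → i ≠ j →
      ∀ Z ∈ a.boolLocs, ∀ Z' ∈ b.boolLocs, v.loc (.orig Z) = v.loc (.orig Z') →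
        v.bool Z i = true → ¬ v.bool Z' j = true := by
  simp only [Spatial.absStar, AForm.sat_conj, List.mem_flatMap, List.mem_map, List.mem_filter,
    decide_eq_true_eq, Spatial.boolVars]
  constructor
  · intro h a i b j ha hb hij Z hZ Z' hZ' heq hbool
    have := h _ ⟨(Z, i), ⟨(a, i), ha, Z, hZ, rfl⟩, (Z', j), ⟨⟨(b, j), hb, Z', hZ', rfl⟩, hij⟩, rfl⟩
    simp only [AForm.imp, AForm.Sat] at this
    tauto
  · rintro h _ ⟨_, ⟨⟨a, i⟩, ha, Z, hZ, rfl⟩, _, ⟨⟨⟨b, j⟩, hb, Z', hZ', rfl⟩, hij⟩, rfl⟩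
    have := h a i b j ha hb hij Z hZ Z' hZ'
    simp only [AForm.imp, AForm.Sat]
    tauto

/-! ### Models of the formula yield models of the abstraction -/

/-- The heap of a spatial formula splits into heaps with disjoint sets of allocated locations, one
for each atom. -/
theorem Spatial.Sat.exists_heaps {s : Assign L LV IV SV} {T : Spatial P LV IV SV}
    {h : Heap L 𝔽 𝔻} (hs : T.Sat s h) (k : ℕ) :
    ∃ f : ℕ → Heap L 𝔽 𝔻,
      (∀ a i, (a, i) ∈ T.atoms.zipIdx k → a.Sat s (f i) ∧ (f i).ldom ⊆ h.ldom) ∧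
      ∀ a i b j, (a, i) ∈ T.atoms.zipIdx k → (b, j) ∈ T.atoms.zipIdx k → i ≠ j →
        Disjoint (f i).ldom (f j).ldom := by
  induction T generalizing h k with
  | emp => exact ⟨fun _ => Heap.empty, by simp [Spatial.atoms], by simp [Spatial.atoms]⟩
  | atom a =>
    refine ⟨fun _ => h, ?_, ?_⟩
    · simp only [Spatial.atoms, List.zipIdx_singleton, List.mem_singleton, Prod.mk.injEq]
      rintro _ _ ⟨rfl, rfl⟩
      exact ⟨hs, subset_rfl⟩
    · simp only [Spatial.atoms, List.zipIdx_singleton, List.mem_singleton, Prod.mk.injEq]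
      rintro _ _ _ _ ⟨-, rfl⟩ ⟨-, rfl⟩ hne
      exact absurd rfl hne
  | star T₁ T₂ ih₁ ih₂ =>
    obtain ⟨h₁, h₂, hu, hs₁, hs₂⟩ := hs
    obtain ⟨f₁, hf₁, hd₁⟩ := ih₁ hs₁ k
    obtain ⟨f₂, hf₂, hd₂⟩ := ih₂ hs₂ (k + T₁.atoms.length)
    have e₁ : ∀ {a i}, (a, i) ∈ T₁.atoms.zipIdx k → i < k + T₁.atoms.length :=
      fun hm => List.snd_lt_add_of_mem_zipIdx hm
    have e₂ : ∀ {a i}, (a, i) ∈ T₂.atoms.zipIdx (k + T₁.atoms.length) →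
        ¬ i < k + T₁.atoms.length := fun hm => not_lt.2 (List.le_snd_of_mem_zipIdx hm)
    refine ⟨fun i => if i < k + T₁.atoms.length then f₁ i else f₂ i, ?_, ?_⟩
    · intro a i hm
      rw [Spatial.atoms, List.zipIdx_append, List.mem_append] at hm
      rw [hu.ldom_eq]
      rcases hm with hm | hm
      · simp only [if_pos (e₁ hm)]
        exact ⟨(hf₁ a i hm).1, (hf₁ a i hm).2.trans Set.subset_union_left⟩
      · simp only [if_neg (e₂ hm)]
        exact ⟨(hf₂ a i hm).1, (hf₂ a i hm).2.trans Set.subset_union_right⟩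
    · intro a i b j hi hj hij
      rw [Spatial.atoms, List.zipIdx_append, List.mem_append] at hi hj
      rcases hi with hi | hi <;> rcases hj with hj | hj
      · simpa only [if_pos (e₁ hi), if_pos (e₁ hj)] using hd₁ a i b j hi hj hij
      · simpa only [if_pos (e₁ hi), if_neg (e₂ hj)] using
          hu.1.mono (hf₁ a i hi).2 (hf₂ b j hj).2
      · simpa only [if_neg (e₂ hi), if_pos (e₁ hj)] using
          (hu.1.mono (hf₁ b j hj).2 (hf₂ a i hi).2).symm
      · simpa only [if_neg (e₂ hi), if_neg (e₂ hj)] using hd₂ a i b j hi hj hij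

/-- The assignment of the abstraction that extends `s` by given values of the fresh variables and
sets `[Z, i]` iff `Z` is allocated in the `i`-th heap. -/
noncomputable def AAssign.ofHeaps (s : Assign L LV IV SV) (f : ℕ → Heap L 𝔽 𝔻)
    (g : ℕ → Fin P.nl → L) (g₁ g₂ : ℕ → Fin P.ns → Finset ℤ) : AAssign P L LV IV SV where
  loc
    | .orig Z => s.loc Z
    | .γ₁ i k => g i k
    | .γ₂ i k => g i k
  int := s.int
  set
    | .orig S => s.set S
    | .γ₁ i k => g₁ i k
    | .γ₂ i k => g₂ i k
  bool Z i := open Classical in decide (s.loc Z ∈ (f i).ldom)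

/-- For each atom there are values of its fresh variables that satisfy its abstraction. -/
theorem Atom.Sat.exists_abs (hP : P.LinearlyCompositional) {s : Assign L LV IV SV}
    (f : ℕ → Heap L 𝔽 𝔻) {i : ℕ} {a : Atom P LV IV SV} (ha : a.Sat s (f i)) :
    ∃ (x : Fin P.nl → L) (x₁ x₂ : Fin P.ns → Finset ℤ),
      ∀ (g : ℕ → Fin P.nl → L) (g₁ g₂ : ℕ → Fin P.ns → Finset ℤ), g i = x → g₁ i = x₁ →
        g₂ i = x₂ → (a.abs i).Sat (AAssign.ofHeaps s f g g₁ g₂) := by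
  cases a with
  | pointsTo E ρ =>
    refine ⟨fun _ => s.loc E, fun _ => ∅, fun _ => ∅, fun g g₁ g₂ _ _ _ => ?_⟩
    simpa [Atom.abs, AForm.Sat, AAssign.ofHeaps] using ha.1.symm ▸ Set.mem_singleton (s.loc E)
  | pred Z₁ μL μS Z₂ νL νS χ =>
    have hc := IndPred.Sem.cases_unfold hP ha
    rcases hc with ⟨h₁, h₂, h₃⟩ | ⟨hmem, h | ⟨x, x₁, x₂, hx, h₁, h₂, h₃⟩⟩
    · refine ⟨s.loc ∘ μL, fun _ => ∅, fun _ => ∅, fun g g₁ g₂ _ _ _ => ?_⟩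
      exact Atom.sat_abs_pred.2 (.inl ⟨h₁, congrFun h₂, congrFun h₃⟩)
    · refine ⟨s.loc ∘ μL, fun _ => ∅, fun _ => ∅, fun g g₁ g₂ _ _ _ => ?_⟩
      exact Atom.sat_abs_pred.2 (.inr ⟨⟨by simpa [AAssign.ofHeaps] using hmem.1,
        fun j hj => by simpa [AAssign.ofHeaps] using hmem.2 j hj⟩, .inl h⟩)
    · refine ⟨x, x₁, x₂, ?_⟩
      rintro g g₁ g₂ rfl rfl rfl
      exact Atom.sat_abs_pred.2 (.inr ⟨⟨by simpa [AAssign.ofHeaps] using hmem.1,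
        fun j hj => by simpa [AAssign.ofHeaps] using hmem.2 j hj⟩, .inr ⟨hx, h₁, h₂, h₃⟩⟩)

theorem Formula.Satisfiable.exists_abs_sat [Nonempty L] (hP : P.LinearlyCompositional)
    {φ : Formula P LV IV SV} (hφ : φ.Satisfiable L) :
    ∃ v : AAssign P L LV IV SV,
      φ.abs.Sat v ∧ φ.DataDefined v.int (fun S => v.set (.orig S)) := by
  obtain ⟨s, h, hpure, hdata, hsp⟩ := hφ
  obtain ⟨f, hf, hd⟩ := hsp.exists_heaps 0
  have hval : ∀ i, ∃ (x : Fin P.nl → L) (x₁ x₂ : Fin P.ns → Finset ℤ),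
      ∀ a, (a, i) ∈ φ.spatial.atoms.zipIdx →
        ∀ (g : ℕ → Fin P.nl → L) (g₁ g₂ : ℕ → Fin P.ns → Finset ℤ), g i = x → g₁ i = x₁ →
          g₂ i = x₂ → (a.abs i).Sat (AAssign.ofHeaps s f g g₁ g₂) := by
    intro i
    simp only [List.mk_mem_zipIdx_iff_getElem?]
    cases ha : φ.spatial.atoms[i]? with
    | none => exact ⟨fun _ => Classical.arbitrary L, fun _ => ∅, fun _ => ∅, by simp⟩
    | some a =>
      obtain ⟨x, x₁, x₂, hx⟩ := Atom.Sat.exists_abs hP f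
        (hf a i (List.mk_mem_zipIdx_iff_getElem?.2 ha)).1
      refine ⟨x, x₁, x₂, fun b hb => ?_⟩
      cases hb
      exact hx
  choose g g₁ g₂ hg using hval
  refine ⟨AAssign.ofHeaps s f g g₁ g₂, ⟨?_, hdata, ?_, ?_⟩, ?_⟩
  · rw [AForm.sat_conj, List.forall_mem_map]
    exact fun p hp => (PureAtom.sat_toAForm p).2 (hpure p hp)
  · rw [Spatial.absAtoms, AForm.sat_conj, List.forall_mem_map]
    exact fun ⟨a, i⟩ hai => hg i a hai g g₁ g₂ rfl rfl rfl
  · rw [Spatial.sat_absStar]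
    intro a i b j ha hb hij Z _ Z' _ heq hZ hZ'
    simp only [AAssign.ofHeaps, decide_eq_true_eq] at heq hZ hZ'
    exact Set.disjoint_left.1 (hd a i b j ha hb hij) hZ (heq ▸ hZ')
  · intro E ρ hmem d t hdt
    obtain ⟨i, hi⟩ := List.mem_iff_getElem?.1 hmem
    obtain ⟨n, hn, -⟩ := (hf _ _ (List.mk_mem_zipIdx_iff_getElem?.2 hi)).1.2.2 d t hdt
    exact Option.isSome_iff_exists.2 ⟨n, hn⟩

/-! ### Models of the abstraction yield models of the formula -/

/-- The locations reserved for the `i`-th atom `a`: the values of the variables `Z` for which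
`[Z, i]` holds. -/
def AAssign.reserved (v : AAssign P L LV IV SV) (a : Atom P LV IV SV) (i : ℕ) : Set L :=
  {l | ∃ Z ∈ a.boolLocs, v.bool Z i = true ∧ v.loc (.orig Z) = l}

theorem AAssign.finite_reserved (v : AAssign P L LV IV SV) (a : Atom P LV IV SV) (i : ℕ) :
    (v.reserved a i).Finite := by
  refine (a.boolLocs.finite_toSet.image fun Z => v.loc (.orig Z)).subset ?_
  rintro _ ⟨Z, hZ, -, rfl⟩
  exact ⟨Z, hZ, rfl⟩

/-- The state of the formula that is part of an assignment of the abstraction. -/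
def AAssign.state (v : AAssign P L LV IV SV) : Assign L LV IV SV where
  loc Z := v.loc (.orig Z)
  int := v.int
  set S := v.set (.orig S)

/-- An atom whose abstraction holds has a heap that, apart from the reserved locations, avoids any
given finite set. -/
theorem Atom.exists_heap_of_abs [Infinite L] (hP : P.LinearlyCompositional) (hg : P.DataGuarded)
    {v : AAssign P L LV IV SV} {a : Atom P LV IV SV} {i : ℕ} (ha : (a.abs i).Sat v)
    (hρ : ∀ E ρ, a = .pointsTo E ρ → (ρ.map Entry.field).Nodup ∧ fieldSet ρ = fieldSet P.ρ ∧
      RhoDefined ρ v.state.int v.state.set)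
    {W : Set L} (hW : W.Finite) :
    ∃ h : Heap L 𝔽 𝔻, a.Sat v.state h ∧ h.HasFields (fieldSet P.ρ) ∧ h.ldom.Finite ∧
      h.ldom ⊆ v.reserved a i ∪ Wᶜ := by
  cases a with
  | pointsTo E ρ =>
    obtain ⟨hnd, hfs, hdef⟩ := hρ E ρ rfl
    have hne : ρ ≠ [] := by
      rintro rfl
      obtain ⟨e, he⟩ := List.exists_mem_of_ne_nil _ hP.ρ_ne_nil
      have : e.field ∈ fieldSet P.ρ := ⟨e, he, rfl⟩
      rw [← hfs] at this
      obtain ⟨_, h, -⟩ := this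
      cases h
    obtain ⟨h, hp, hf⟩ := exists_pointsTo hnd hne (v.state.loc E) v.state.loc v.state.int
      v.state.set hdef
    refine ⟨h, hp, hfs ▸ hf, by simp [hp.1], ?_⟩
    rw [hp.1, Set.singleton_subset_iff]
    exact .inl ⟨E, by simp [Atom.boolLocs], ha, rfl⟩
  | pred Z₁ μL μS Z₂ νL νS χ =>
    rw [Atom.sat_abs_pred] at ha
    rcases ha with ⟨h₁, h₂, h₃⟩ | ⟨⟨hb, hbj⟩, ⟨hrel, hidx⟩ | ⟨hidx, h₁, h₂, h₃⟩⟩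
    · refine ⟨Heap.empty, ?_, Heap.hasFields_empty _, by simp, by simp⟩
      change P.Sem (v.loc (.orig Z₂)) (fun k => v.loc (.orig (νL k)))
        (fun k => v.set (.orig (νS k))) _ Heap.empty (v.loc (.orig Z₁))
        (fun k => v.loc (.orig (μL k))) (fun k => v.set (.orig (μS k)))
      rw [h₁, funext h₂, funext h₃]
      exact .base _ Heap.ldom_empty
    · obtain ⟨h, hs, hf, hd⟩ := hP.exists_sem_one hg (v.state.loc Z₂) (v.state.loc ∘ νL)
        (v.state.loc ∘ χ) (v.state.loc ∘ μL) hrel fun j hj => (hidx j hj).symm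
      refine ⟨h, hs, hf, by simp [hd], ?_⟩
      rw [hd, Set.singleton_subset_iff]
      exact .inl ⟨Z₁, Atom.mem_boolLocs_pred.2 (.inl rfl), hb, rfl⟩
    -- The last cell is at `ν_j` if `E` occurs in `γ`, and at a fresh location otherwise.
    · obtain ⟨t, ht, htE, htW⟩ : ∃ t, (∀ j, P.idx = some j → v.loc (.orig (νL j)) = t) ∧
          v.loc (.orig Z₁) ≠ t ∧
          t ∈ v.reserved (.pred Z₁ μL μS Z₂ νL νS χ) i ∪ Wᶜ := by
        cases hi : P.idx with
        | none =>
          obtain ⟨t, ht⟩ := (hW.insert (v.loc (.orig Z₁))).exists_notMem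
          rw [Set.mem_insert_iff, not_or] at ht
          exact ⟨t, by simp, Ne.symm ht.1, .inr ht.2⟩
        | some j =>
          exact ⟨_, by rintro _ ⟨⟩; rfl, (hidx j hi).1,
            .inl ⟨νL j, Atom.mem_boolLocs_pred.2 (.inr ⟨j, hi, rfl⟩), hbj j hi, rfl⟩⟩
      obtain ⟨h, hs, hf, hfin, hd⟩ := hP.exists_sem_of_transGen hg (v.state.loc Z₂)
        (v.state.loc ∘ νL) (v.state.loc ∘ χ) ht h₁ (.head' h₂ h₃) htE (v.state.loc ∘ μL) hW
      refine ⟨h, hs, hf, hfin, hd.trans ?_⟩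
      rintro l ((rfl | rfl) | hl)
      · exact .inl ⟨Z₁, Atom.mem_boolLocs_pred.2 (.inl rfl), hb, rfl⟩
      · exact htW
      · exact .inr hl

/-- The heaps of the atoms may be chosen one after the other, each of them disjoint from the
preceding ones and from the locations reserved for the others. -/
theorem Spatial.exists_heap_of_atoms {s : Assign L LV IV SV} {R : Set (𝔽 ⊕ 𝔻)}
    {res : Atom P LV IV SV → ℕ → Set L} (hres : ∀ a i, (res a i).Finite)
    (T : Spatial P LV IV SV) (k : ℕ)
    (hex : ∀ a i, (a, i) ∈ T.atoms.zipIdx k → ∀ W : Set L, W.Finite →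
      ∃ h : Heap L 𝔽 𝔻, a.Sat s h ∧ h.HasFields R ∧ h.ldom.Finite ∧ h.ldom ⊆ res a i ∪ Wᶜ)
    (hdisj : ∀ a i b j, (a, i) ∈ T.atoms.zipIdx k → (b, j) ∈ T.atoms.zipIdx k → i ≠ j →
      Disjoint (res a i) (res b j)) {W : Set L} (hW : W.Finite) :
    ∃ h : Heap L 𝔽 𝔻, T.Sat s h ∧ h.HasFields R ∧ h.ldom.Finite ∧
      h.ldom ⊆ (⋃ p ∈ T.atoms.zipIdx k, res p.1 p.2) ∪ Wᶜ := by
  induction T generalizing k W with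
  | emp => exact ⟨Heap.empty, Heap.ldom_empty, Heap.hasFields_empty _, by simp, by simp⟩
  | atom a => simpa [Spatial.atoms, Spatial.Sat] using hex a k (by simp [Spatial.atoms]) W hW
  | star T₁ T₂ ih₁ ih₂ =>
    simp only [Spatial.atoms, List.zipIdx_append, List.mem_append] at hex hdisj
    have hfin₂ : (⋃ p ∈ T₂.atoms.zipIdx (k + T₁.atoms.length), res p.1 p.2).Finite :=
      (List.finite_toSet _).biUnion fun p _ => hres p.1 p.2
    obtain ⟨h₁, hs₁, hf₁, hd₁, hsub₁⟩ := ih₁ k (fun a i ha => hex a i (.inl ha))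
      (fun a i b j ha hb => hdisj a i b j (.inl ha) (.inl hb)) (hW.union hfin₂)
    obtain ⟨h₂, hs₂, hf₂, hd₂, hsub₂⟩ := ih₂ _ (fun a i ha => hex a i (.inr ha))
      (fun a i b j ha hb => hdisj a i b j (.inr ha) (.inr hb)) (hW.union hd₁)
    have hd : Disjoint h₁.ldom h₂.ldom := by
      rw [Set.disjoint_left]
      intro l hl₁ hl₂
      have hr₂ : l ∈ ⋃ p ∈ T₂.atoms.zipIdx (k + T₁.atoms.length), res p.1 p.2 :=
        (hsub₂ hl₂).resolve_right fun hc => hc (.inr hl₁)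
      have hr₁ := (hsub₁ hl₁).resolve_right fun hc => hc (.inr hr₂)
      simp only [Set.mem_iUnion] at hr₁ hr₂
      obtain ⟨⟨a, i⟩, ha, hla⟩ := hr₁
      obtain ⟨⟨b, j⟩, hb, hlb⟩ := hr₂
      have hij : i < j :=
        (List.snd_lt_add_of_mem_zipIdx ha).trans_le (List.le_snd_of_mem_zipIdx hb)
      exact Set.disjoint_left.1 (hdisj a i b j (.inl ha) (.inr hb) hij.ne) hla hlb
    obtain ⟨h, hu, hf⟩ := hf₁.exists_isUnion hf₂ hd
    refine ⟨h, ⟨h₁, h₂, hu, hs₁, hs₂⟩, hf, ?_, ?_⟩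
    · rw [hu.ldom_eq]
      exact hd₁.union hd₂
    · simp only [Spatial.atoms, List.zipIdx_append, List.mem_append, Set.iUnion_or,
        Set.iUnion_union_distrib, hu.ldom_eq]
      rintro l (hl | hl)
      · rcases hsub₁ hl with h | h
        · exact .inl (.inl h)
        · exact .inr fun hc => h (.inl hc)
      · rcases hsub₂ hl with h | h
        · exact .inl (.inr h)
        · exact .inr fun hc => h (.inl hc)

theorem Formula.satisfiable_of_abs_sat [Infinite L] (hP : P.LinearlyCompositional)
    (hg : P.DataGuarded) {φ : Formula P LV IV SV} (hφ : φ.WellFormed) {v : AAssign P L LV IV SV}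
    (hv : φ.abs.Sat v) (hdef : φ.DataDefined v.int fun S => v.set (.orig S)) :
    φ.Satisfiable L := by
  obtain ⟨hpure, hdata, hatoms, hstar⟩ := hv
  rw [AForm.sat_conj, List.forall_mem_map] at hpure
  rw [Spatial.absAtoms, AForm.sat_conj, List.forall_mem_map] at hatoms
  rw [Spatial.sat_absStar] at hstar
  obtain ⟨h, hs, -⟩ := Spatial.exists_heap_of_atoms (s := v.state) (R := fieldSet P.ρ)
    v.finite_reserved φ.spatial 0
    (fun a i ha W hW => by
      refine Atom.exists_heap_of_abs hP hg (hatoms (a, i) ha) ?_ hW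
      rintro E ρ rfl
      have hmem := List.fst_mem_of_mem_zipIdx ha
      exact ⟨(hφ E ρ hmem).1, (hφ E ρ hmem).2, hdef E ρ hmem⟩)
    (fun a i b j ha hb hij => by
      rw [Set.disjoint_left]
      rintro _ ⟨Z, hZ, hZb, rfl⟩ ⟨Z', hZ', hZb', heq⟩
      exact hstar a i b j ha hb hij Z hZ Z' hZ' heq.symm hZb hZb')
    Set.finite_empty
  exact ⟨v.state, h, fun p hp => (PureAtom.sat_toAForm p).1 (hpure p hp), hdata, hs⟩

end

end SLID

theorem mainTheorem4 {𝔽 𝔻 L LV IV SV : Type*} [Infinite L]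
    (P : SLID.IndPred 𝔽 𝔻) (hP : P.LinearlyCompositional)
    (φ : SLID.Formula P LV IV SV) (hφ : φ.WellFormed) :
    (P.DataGuarded → φ.DataGuarded → (φ.Satisfiable L ↔ φ.abs.Satisfiable L)) ∧
    (P.DataGuarded → (φ.Satisfiable L ↔ ∃ v : SLID.AAssign P L LV IV SV,
      φ.abs.Sat v ∧ φ.DataDefined v.int (fun S => v.set (.orig S)))) ∧
    (φ.Satisfiable L → φ.abs.Satisfiable L) := by
  have hnec : φ.Satisfiable L → φ.abs.Satisfiable L := fun h =>
    (h.exists_abs_sat hP).imp fun _ hv => hv.1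
  refine ⟨fun hg hφg => ⟨hnec, fun ⟨v, hv⟩ => ?_⟩,
    fun hg => ⟨fun h => h.exists_abs_sat hP, fun ⟨v, hv, hdef⟩ => ?_⟩, hnec⟩
  · exact SLID.Formula.satisfiable_of_abs_sat hP hg hφ hv (hφg _ _ hv.2.1)
  · exact SLID.Formula.satisfiable_of_abs_sat hP hg hφ hv hdef
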